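/- Let $M$ be an open Riemannian manifold, that is, a connected, complete, non-compact smooth Riemannian manifold without boundary, and let $\mathrm{dvol}_M$ denote its Riemannian volume measure. The bottom of the spectrum of $M$ is $$\lambda_0(M):=\inf\left\{\frac{\int_M|\nabla f|^2\,\mathrm{dvol}_M}{\int_M f^2\,\mathrm{dvol}_M}\ \middle|\ f\in C_c^\infty(M),\ f\not\equiv 0\right\}.$$ If $M$ has finite volume, $\mathrm{Vol}(M)=\int_M \mathrm{dvol}_M<\infty$, then $\lambda_0(M)=0$. -/

import Mathlib

open scoped Manifold ContDiff ENNReal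
open MeasureTheory Bundle

noncomputable section

namespace OpenRiemannian

section Volume

/-- The Gram matrix `g_ij = ⟨∂_i, ∂_j⟩` of a Riemannian metric in the chart `e`, at the point with
coordinates `y`. Here `∂_i` is the image of the `i`-th standard basis vector under the differential
of `e⁻¹` at `y`. -/
def gramMatrix {n : ℕ} {M : Type*} [TopologicalSpace M] [ChartedSpace (EuclideanSpace ℝ (Fin n)) M]
    [RiemannianBundle (fun x : M ↦ TangentSpace (𝓡 n) x)]
    (e : OpenPartialHomeomorph M (EuclideanSpace ℝ (Fin n))) (y : EuclideanSpace ℝ (Fin n)) :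
    Matrix (Fin n) (Fin n) ℝ :=
  Matrix.of fun i j ↦
    inner ℝ
      (mfderiv (𝓡 n) (𝓡 n) e.symm y (EuclideanSpace.single i (1 : ℝ)) : TangentSpace (𝓡 n) (e.symm y))
      (mfderiv (𝓡 n) (𝓡 n) e.symm y (EuclideanSpace.single j (1 : ℝ)) : TangentSpace (𝓡 n) (e.symm y))

/-- The Riemannian volume in the chart `e`: the measure `√det(g_ij) dy` on the target of `e`,
transported to `M` by `e⁻¹`, so that a Borel set `A` has measure `∫ √det(g_ij) dy` over the part of
the target that `e⁻¹` maps into `A`. -/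
def chartVolume {n : ℕ} {M : Type*} [TopologicalSpace M] [ChartedSpace (EuclideanSpace ℝ (Fin n)) M]
    [RiemannianBundle (fun x : M ↦ TangentSpace (𝓡 n) x)] [MeasurableSpace M]
    (e : OpenPartialHomeomorph M (EuclideanSpace ℝ (Fin n))) : Measure M :=
  ((volume.restrict e.target).withDensity
    (fun y ↦ ENNReal.ofReal (Real.sqrt (gramMatrix e y).det))).map e.symm

/-- The Riemannian volume measure `dvol_M`: the least measure that dominates the volume
`√det(g_ij) dy` of every chart of the atlas. The chart volumes agree on overlaps (change of
variables), so on a second countable manifold this is the unique Borel measure which is given by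
`√det(g_ij) dy` in each chart. -/
def volumeMeasure (n : ℕ) (M : Type*) [TopologicalSpace M]
    [ChartedSpace (EuclideanSpace ℝ (Fin n)) M]
    [RiemannianBundle (fun x : M ↦ TangentSpace (𝓡 n) x)] [MeasurableSpace M] : Measure M :=
  ⨆ e ∈ atlas (EuclideanSpace ℝ (Fin n)) M, chartVolume e

end Volume

section Spectrum

/-- The Riemannian gradient of `f` at `x`: the tangent vector `∇f` with `⟨∇f, v⟩ = df(v)` for all
tangent vectors `v` at `x`. -/
def grad {n : ℕ} {M : Type*} [TopologicalSpace M] [ChartedSpace (EuclideanSpace ℝ (Fin n)) M]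
    [RiemannianBundle (fun x : M ↦ TangentSpace (𝓡 n) x)] (f : M → ℝ) (x : M) :
    TangentSpace (𝓡 n) x :=
  haveI : FiniteDimensional ℝ (TangentSpace (𝓡 n) x) :=
    inferInstanceAs (FiniteDimensional ℝ (EuclideanSpace ℝ (Fin n)))
  haveI : CompleteSpace (TangentSpace (𝓡 n) x) := FiniteDimensional.complete ℝ _
  (InnerProductSpace.toDual ℝ (TangentSpace (𝓡 n) x)).symm (mfderiv (𝓡 n) 𝓘(ℝ, ℝ) f x)

/-- The Rayleigh quotient `∫ |∇f|² dvol / ∫ f² dvol`, as an element of `[0, ∞]`. -/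
def rayleighQuotient {n : ℕ} {M : Type*} [TopologicalSpace M]
    [ChartedSpace (EuclideanSpace ℝ (Fin n)) M]
    [RiemannianBundle (fun x : M ↦ TangentSpace (𝓡 n) x)] [MeasurableSpace M] (f : M → ℝ) : ℝ≥0∞ :=
  (∫⁻ x, ENNReal.ofReal (‖grad (n := n) f x‖ ^ 2) ∂(volumeMeasure n M)) /
    ∫⁻ x, ENNReal.ofReal (f x ^ 2) ∂(volumeMeasure n M)

/-- The bottom `λ₀(M)` of the spectrum: the infimum of the Rayleigh quotients of the smooth
compactly supported functions that do not vanish identically. The infimum is taken in `[0, ∞]`, so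
it would be `∞`, not `0`, if there were no such functions. -/
def bottomSpectrum (n : ℕ) (M : Type*) [TopologicalSpace M]
    [ChartedSpace (EuclideanSpace ℝ (Fin n)) M]
    [RiemannianBundle (fun x : M ↦ TangentSpace (𝓡 n) x)] [MeasurableSpace M] : ℝ≥0∞ :=
  ⨅ f ∈ {f : M → ℝ | ContMDiff (𝓡 n) 𝓘(ℝ, ℝ) ∞ f ∧ HasCompactSupport f ∧ f ≠ 0},
    rayleighQuotient (n := n) f

end Spectrum

end OpenRiemannian

end

/-! A test function equal to `1` on the unit ball about `p`, with gradient at most `ε`, has Rayleigh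
quotient at most `ε² Vol(M) / Vol(B(p,1))` (`rayleighQuotient_le`). Since the volume of `M` is
finite and that of the ball is positive (`volumeMeasure_ne_zero_of_isOpen`), letting `ε → 0` gives
the result.

Such test functions come from the tent `max (1 - δ d(p,·)) 0`. It is `δ`-Lipschitz, and its support
is compact by Hopf–Rinow (`isCompact_closedEBall`), which is where completeness enters. It is not
smooth, so it is mollified in charts and glued by a partition of unity (`exists_contMDiff_approx`).
The gradient bound becomes `4δ` plus a small error, which is harmless because `δ` is arbitrary.
Composition with a smooth step function then restores the exact value `1` on the ball and `0` far
away (`exists_cutoff_small_gradient`). -/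

open scoped Manifold ContDiff ENNReal
open MeasureTheory Bundle

noncomputable section

namespace OpenRiemannian

/-! ### Length spaces and the Hopf–Rinow theorem. -/

section LengthSpace

open Set Filter Topology

/-- Between two points at finite distance and for every intermediate value `s` of the distance, there
is a point at distance `s` from the first one which almost realizes the triangle equality. -/
def HasIntermediatePoints (X : Type*) [PseudoEMetricSpace X] : Prop :=
  ∀ (x y : X) (s ε : ℝ≥0∞), s ≤ edist x y → edist x y ≠ ⊤ → 0 < ε →
    ∃ z, edist x z = s ∧ edist z y ≤ edist x y - s + ε

/-- On a path of length less than `edist x y + ε`, the intermediate value theorem gives a point at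
distance `s` from `x`. The path up to it has length at least `s`, so the rest has length at most
`edist x y - s + ε`. -/
lemma IsRiemannianManifold.hasIntermediatePoints {E : Type*} [NormedAddCommGroup E]
    [NormedSpace ℝ E] {H : Type*} [TopologicalSpace H] (I : ModelWithCorners ℝ E H)
    (M : Type*) [PseudoEMetricSpace M] [ChartedSpace H M]
    [RiemannianBundle (fun x : M ↦ TangentSpace I x)] [IsRiemannianManifold I M] :
    HasIntermediatePoints M := by
  intro x y s ε hs hxy hε
  have hlt : Manifold.riemannianEDist I x y < edist x y + ε := by
    rw [← IsRiemannianManifold.out (I := I) x y]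
    exact ENNReal.lt_add_right hxy hε.ne'
  obtain ⟨γ, hγ0, hγ1, hγ, hlen⟩ := Manifold.exists_lt_of_riemannianEDist_lt hlt
  have hcont : ContinuousOn (fun t ↦ edist x (γ t)) (Icc 0 1) :=
    (by fun_prop : Continuous (edist x)).comp_continuousOn hγ.continuousOn
  obtain ⟨t, ht, hst⟩ : s ∈ (fun t ↦ edist x (γ t)) '' Icc 0 1 := by
    apply intermediate_value_Icc zero_le_one hcont
    simp [hγ0, hγ1, hs]
  refine ⟨γ t, hst, ?_⟩
  have h1 : s ≤ Manifold.pathELength I γ 0 t := by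
    rw [← hst]
    dsimp only
    rw [IsRiemannianManifold.out (I := I) x (γ t)]
    exact Manifold.riemannianEDist_le_pathELength (hγ.mono (Icc_subset_Icc_right ht.2)) hγ0 rfl ht.1
  have h2 : edist (γ t) y ≤ Manifold.pathELength I γ t 1 := by
    rw [IsRiemannianManifold.out (I := I) (γ t) y]
    exact Manifold.riemannianEDist_le_pathELength (hγ.mono (Icc_subset_Icc_left ht.1)) rfl hγ1 ht.2
  have hsT : s ≠ ⊤ := ne_top_of_le_ne_top hxy hs
  have h3 : s + edist (γ t) y ≤ edist x y + ε :=
    (add_le_add h1 h2).trans ((Manifold.pathELength_add ht.1 ht.2).trans_le hlen.le)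
  have h4 : edist (γ t) y ≤ edist x y + ε - s := by
    rw [ENNReal.le_sub_iff_add_le_left hsT]
    · exact h3
    · exact hs.trans le_self_add
  exact h4.trans (ENNReal.sub_add_eq_add_sub hs hsT).ge

variable {X : Type*} [EMetricSpace X]

/-- The only form in which Hopf–Rinow uses the length structure: enlarging the radius by `δ` adds
only points almost `δ`-close to the smaller ball. -/
lemma exists_mem_closedEBall_edist_le (hX : HasIntermediatePoints X) (p : X) {R δ ε : ℝ≥0∞}
    (hR : R ≠ ⊤) (hδ : δ ≠ ⊤) (hε : 0 < ε) {x : X} (hx : x ∈ Metric.closedEBall p (R + δ)) :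
    ∃ z ∈ Metric.closedEBall p R, edist z x ≤ δ + ε := by
  rw [Metric.mem_closedEBall, edist_comm] at hx
  rcases le_total (edist p x) R with h | h
  · exact ⟨x, by rwa [Metric.mem_closedEBall, edist_comm], by simp⟩
  obtain ⟨z, hz, hzx⟩ := hX p x R ε h
    (ne_top_of_le_ne_top (ENNReal.add_ne_top.2 ⟨hR, hδ⟩) hx) hε
  refine ⟨z, by rw [Metric.mem_closedEBall, edist_comm, hz], hzx.trans ?_⟩
  gcongr
  exact tsub_le_iff_left.2 hx

/-- The Hopf–Rinow–Cohn-Vossen theorem: balls of finite radius in a complete locally compact length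
space are relatively compact. -/
theorem isCompact_closedEBall [CompleteSpace X] [LocallyCompactSpace X]
    (hX : HasIntermediatePoints X) (p : X) (r : NNReal) :
    IsCompact (Metric.closedEBall p (r : ℝ≥0∞)) := by
  by_contra hr
  set S : Set NNReal := {t | IsCompact (Metric.closedEBall p (t : ℝ≥0∞))} with hS
  have hmono : ∀ t ∈ S, ∀ t' ≤ t, t' ∈ S := fun t ht t' htt' ↦
    IsCompact.of_isClosed_subset ht Metric.isClosed_closedEBall
      (Metric.closedEBall_subset_closedEBall (by exact_mod_cast htt'))
  have h0 : (0 : NNReal) ∈ S := by simp [hS]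
  have hbdd : BddAbove S := ⟨r, fun t ht ↦ le_of_not_ge fun h ↦ hr (hmono t ht r h)⟩
  -- Continuity argument on radii: `R` itself lies in `S`, and then so does a slightly larger
  -- radius, which is absurd.
  set R := sSup S with hR
  have hlt : ∀ t < R, t ∈ S := fun t ht ↦ by
    obtain ⟨t', ht', h⟩ := exists_lt_of_lt_csSup ⟨0, h0⟩ ht
    exact hmono t' ht' t h.le
  have hRS : R ∈ S := by
    rcases eq_or_lt_of_le (zero_le : 0 ≤ R) with h | hRpos
    · rwa [← h]
    refine isCompact_iff_totallyBounded_isComplete.2 ⟨?_, Metric.isClosed_closedEBall.isComplete⟩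
    rw [EMetric.totallyBounded_iff]
    intro ε hε
    -- A finite `δ`-net of the compact ball of radius `R - δ` is an `ε`-net of the ball of radius
    -- `R`: at most `2δ` to reach the smaller ball, then less than `δ` to the net.
    obtain ⟨δ, hδ, hδε⟩ : ∃ δ : NNReal, 0 < δ ∧ (δ : ℝ≥0∞) + δ + δ ≤ ε := by
      obtain ⟨δ, hδ, h⟩ := ENNReal.lt_iff_exists_nnreal_btwn.1 hε
      refine ⟨δ / 3, by simpa using hδ, le_trans (le_of_eq ?_) h.le⟩
      norm_cast
      rw [← add_div, ← add_div, div_eq_iff (by norm_num)]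
      ring
    have hc : IsCompact (Metric.closedEBall p ((R - δ : NNReal) : ℝ≥0∞)) :=
      hlt _ (tsub_lt_self hRpos hδ)
    obtain ⟨t, ht, htc⟩ := EMetric.totallyBounded_iff.1 hc.totallyBounded δ (by simpa)
    refine ⟨t, ht, fun x hx ↦ ?_⟩
    -- The subtraction is truncated, but `R ≤ (R - δ) + δ` holds even when `δ > R`.
    have hx' : x ∈ Metric.closedEBall p (((R - δ : NNReal) : ℝ≥0∞) + δ) := by
      refine Metric.closedEBall_subset_closedEBall ?_ hx
      exact_mod_cast le_tsub_add
    obtain ⟨z, hz, hzx⟩ := exists_mem_closedEBall_edist_le hX p ENNReal.coe_ne_top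
      ENNReal.coe_ne_top (ε := δ) (by simpa) hx'
    obtain ⟨y, hy, hzy⟩ := mem_iUnion₂.1 (htc hz)
    refine mem_iUnion₂.2 ⟨y, hy, ?_⟩
    rw [Metric.mem_eball] at hzy ⊢
    calc edist x y ≤ edist x z + edist z y := edist_triangle _ _ _
      _ < (δ + δ) + δ := by
        rw [edist_comm x z]
        exact ENNReal.add_lt_add_of_le_of_lt (ne_top_of_le_ne_top (by simp) hzx) hzx hzy
      _ ≤ ε := hδε
  -- Local compactness gives a compact `K` containing the `δ`-thickening of the ball. Points of the
  -- ball of radius `R + δ/4` are within `δ/4 + δ/4 < δ` of it.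
  obtain ⟨K, hK, hKR⟩ := exists_compact_superset hRS
  obtain ⟨δ, hδ, hδK⟩ := IsCompact.exists_thickening_subset_open hRS isOpen_interior hKR
  lift δ to NNReal using hδ.le
  have hδ' : 0 < δ / 4 := div_pos (by exact_mod_cast hδ) (by norm_num)
  have hsub : Metric.closedEBall p ((R + δ / 4 : NNReal) : ℝ≥0∞) ⊆ K := by
    intro x hx
    obtain ⟨z, hz, hzx⟩ := exists_mem_closedEBall_edist_le hX p (R := R) (δ := (δ / 4 : NNReal))
      (ε := (δ / 4 : NNReal)) ENNReal.coe_ne_top ENNReal.coe_ne_top (by exact_mod_cast hδ')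
      (by exact_mod_cast hx)
    refine interior_subset (hδK ((Metric.mem_thickening_iff_exists_edist_lt _ _).2 ⟨z, hz, ?_⟩))
    rw [edist_comm, ENNReal.ofReal_coe_nnreal]
    refine hzx.trans_lt ?_
    norm_cast
    rw [← NNReal.coe_lt_coe] at hδ' ⊢
    push_cast at hδ' ⊢
    linarith
  have hmem : R + δ / 4 ∈ S := hK.of_isClosed_subset Metric.isClosed_closedEBall hsub
  exact (lt_add_of_pos_right R hδ').not_ge (le_csSup hbdd hmem)

/-- The points at finite distance from `x` form a clopen set. -/
lemma edist_ne_top_of_connectedSpace [ConnectedSpace X] (x y : X) : edist x y ≠ ⊤ := by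
  have h : IsClopen (Metric.eball x ⊤) := ⟨Metric.isClosed_eball_top, Metric.isOpen_eball⟩
  have hy : y ∈ Metric.eball x ⊤ := by
    rw [h.eq_univ ⟨x, Metric.mem_eball_self (by simp)⟩]
    trivial
  rw [edist_comm]
  exact (Metric.mem_eball.1 hy).ne

/-- Needed for partitions of unity; the compact balls of integer radius exhaust the space. -/
lemma sigmaCompactSpace_of_hasIntermediatePoints [CompleteSpace X] [LocallyCompactSpace X]
    [ConnectedSpace X] (hX : HasIntermediatePoints X) : SigmaCompactSpace X := by
  obtain ⟨p⟩ := (inferInstance : Nonempty X)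
  refine ⟨⟨fun k ↦ Metric.closedEBall p ((k : NNReal) : ℝ≥0∞),
    fun k ↦ isCompact_closedEBall hX p k, eq_univ_of_forall fun x ↦ mem_iUnion.2 ?_⟩⟩
  obtain ⟨k, hk⟩ := exists_nat_ge (edist x p).toNNReal
  refine ⟨k, Metric.mem_closedEBall.2 ?_⟩
  rw [← ENNReal.coe_toNNReal (edist_ne_top_of_connectedSpace x p)]
  exact_mod_cast hk

end LengthSpace

/-! ### Mollification in a vector space. -/

section Mollification

open Set Metric Convolution ContinuousLinearMap

variable {E : Type*} [NormedAddCommGroup E] [NormedSpace ℝ E] [FiniteDimensional ℝ E]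

/-- A function which is Lipschitz with respect to a seminorm near a point is uniformly approximated
there by smooth functions whose differential satisfies the same bound. -/
theorem exists_contDiff_approx_of_lipschitz_seminorm (N : Seminorm ℝ E) {A : ℝ} (hA : 0 ≤ A)
    (hN : ∀ v, N v ≤ A * ‖v‖) {h : E → ℝ} {c : E} {r L : ℝ} (hr : 0 < r) (hL : 0 ≤ L)
    (hh : ∀ z ∈ ball c (2 * r), ∀ z' ∈ ball c (2 * r), |h z - h z'| ≤ L * N (z - z')) {η : ℝ}
    (hη : 0 < η) :
    ∃ u : E → ℝ, ContDiff ℝ ∞ u ∧ (∀ z ∈ ball c r, |u z - h z| ≤ η) ∧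
      ∀ z ∈ ball c r, ∀ v, |fderiv ℝ u z v| ≤ L * N v := by
  borelize E
  let μ : Measure E := Measure.addHaar
  -- Mollifying at scale `ε` moves `h` by at most `L * A * ε`, and `ε ≤ r` keeps the averages about
  -- `ball c r` inside `ball c (2 * r)`. The `+ 1` in the witness avoids a zero denominator.
  obtain ⟨ε, hε, hεr, hεη⟩ : ∃ ε > 0, ε ≤ r ∧ L * (A * ε) ≤ η := by
    refine ⟨min r (η / (L * A + 1)), lt_min hr (by positivity), min_le_left _ _, ?_⟩
    calc L * (A * min r (η / (L * A + 1))) ≤ L * (A * (η / (L * A + 1))) := by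
          gcongr
          exact min_le_right _ _
      _ = η * ((L * A) / (L * A + 1)) := by ring
      _ ≤ η * 1 := by
          gcongr
          rw [div_le_one (by positivity)]
          linarith
      _ = η := mul_one _
  have hcont : ContinuousOn h (ball c (2 * r)) := by
    refine LipschitzOnWith.continuousOn (K := (L * A).toNNReal)
      (LipschitzOnWith.of_dist_le_mul fun x hx y hy ↦ ?_)
    rw [Real.dist_eq, dist_eq_norm, Real.coe_toNNReal _ (by positivity), mul_assoc]
    exact (hh x hx y hy).trans (by gcongr; exact hN _)
  have hbound : ∀ z ∈ ball c (2 * r), ‖h z‖ ≤ |h c| + L * (A * (2 * r)) := by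
    intro z hz
    have h1 := hh z hz c (mem_ball_self (by positivity))
    have h2 : N (z - c) ≤ A * (2 * r) :=
      (hN _).trans (by gcongr; exact (mem_ball_iff_norm.1 hz).le)
    have h3 : L * N (z - c) ≤ L * (A * (2 * r)) := by gcongr
    rw [Real.norm_eq_abs]
    have := abs_sub_abs_le_abs_sub (h z) (h c)
    linarith
  -- Nothing is known of `h` off the ball; extension by zero makes the convolution globally defined
  -- and smooth.
  set g : E → ℝ := (ball c (2 * r)).indicator h with hg
  have hgint : LocallyIntegrable g μ := by
    apply Integrable.locallyIntegrable
    rw [hg, integrable_indicator_iff measurableSet_ball]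
    exact IntegrableOn.of_bound measure_ball_lt_top
      (hcont.aestronglyMeasurable measurableSet_ball) _
      ((ae_restrict_iff' measurableSet_ball).2 (.of_forall hbound))
  set φ : ContDiffBump (0 : E) := ⟨ε / 2, ε, half_pos hε, half_lt_self hε⟩
  set u : E → ℝ := φ.normed μ ⋆[lsmul ℝ ℝ, μ] g with hu
  have hball : ∀ z ∈ ball c r, ∀ x ∈ ball z ε, x ∈ ball c (2 * r) := by
    intro z hz x hx
    rw [mem_ball] at *
    linarith [dist_triangle x z c]
  have husm : ContDiff ℝ ∞ u :=
    φ.hasCompactSupport_normed.contDiff_convolution_left _ φ.contDiff_normed hgint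
  have hball2 : ∀ z ∈ ball c r, z ∈ ball c (2 * r) := fun z hz ↦ hball z hz z (mem_ball_self hε)
  have hconv : ∀ z, ConvolutionExistsAt (φ.normed μ) g z (lsmul ℝ ℝ) μ := fun z ↦
    φ.hasCompactSupport_normed.convolutionExists_left _ φ.continuous_normed hgint z
  -- `u` averages translates of `h` with nonnegative weights of total mass `1`, so the Lipschitz
  -- bound survives with the same constant.
  have hlip : ∀ z ∈ ball c r, ∀ z' ∈ ball c r, |u z' - u z| ≤ L * N (z' - z) := by
    intro z hz z' hz'
    have h1 : u z' - u z = ∫ t, φ.normed μ t * (g (z' - t) - g (z - t)) ∂μ := by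
      simp only [hu, MeasureTheory.convolution_def]
      rw [← integral_sub (hconv z') (hconv z)]
      simp [mul_sub]
    have h2 : L * N (z' - z) = ∫ t, φ.normed μ t * (L * N (z' - z)) ∂μ := by
      rw [integral_mul_const, φ.integral_normed, one_mul]
    rw [h1, h2, ← Real.norm_eq_abs]
    refine norm_integral_le_of_norm_le (φ.integrable_normed.mul_const _) (.of_forall fun t ↦ ?_)
    rw [norm_mul, Real.norm_of_nonneg (φ.nonneg_normed t)]
    by_cases ht : t ∈ ball (0 : E) ε
    · have ha : z' - t ∈ ball c (2 * r) := hball z' hz' _ (by simpa using ht)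
      have hb : z - t ∈ ball c (2 * r) := hball z hz _ (by simpa using ht)
      gcongr
      · exact φ.nonneg_normed t
      · simp only [hg, indicator_of_mem ha, indicator_of_mem hb, Real.norm_eq_abs]
        simpa using hh _ ha _ hb
    · have : φ.normed μ t = 0 := by
        rw [← Function.notMem_support, φ.support_normed_eq]
        exact ht
      simp [this]
  refine ⟨u, husm, fun z hz ↦ ?_, fun z hz v ↦ ?_⟩
  · have h1 : g z = h z := indicator_of_mem (hball2 z hz) _
    rw [← h1, ← Real.dist_eq]
    refine φ.dist_normed_convolution_le hgint.aestronglyMeasurable fun x hx ↦ ?_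
    have hx' := hball z hz x hx
    rw [h1, hg, indicator_of_mem hx', Real.dist_eq]
    refine (hh x hx' z (hball2 z hz)).trans (le_trans ?_ hεη)
    gcongr
    exact (hN _).trans (by gcongr; exact (mem_ball_iff_norm.1 hx).le)
  · have hd : HasFDerivAt u (fderiv ℝ u z) z :=
      (husm.differentiable (by simp)).differentiableAt.hasFDerivAt
    have hlim := (hd.hasLineDerivAt v).tendsto_slope_zero_right
    refine le_of_tendsto hlim.abs ?_
    have hnhds : ∀ᶠ t in nhds (0 : ℝ), z + t • v ∈ ball c r := by
      have : ContinuousAt (fun t : ℝ ↦ z + t • v) 0 := by fun_prop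
      exact this (isOpen_ball.mem_nhds (by simpa using hz))
    filter_upwards [nhdsWithin_le_nhds hnhds, self_mem_nhdsWithin] with t ht ht0
    have ht0 : 0 < t := ht0
    have := hlip z hz _ ht
    rw [add_sub_cancel_left, map_smul_eq_mul, Real.norm_of_nonneg ht0.le] at this
    rw [smul_eq_mul, abs_mul, abs_of_pos (inv_pos.2 ht0), inv_mul_le_iff₀ ht0]
    linarith

end Mollification

/-! ### Comparison of the Riemannian metric with a chart. -/

section Charts

open Set Filter Topology Metric

variable {E : Type*} [NormedAddCommGroup E] [NormedSpace ℝ E]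
  {M : Type*} [PseudoEMetricSpace M] [ChartedSpace E M] [IsManifold 𝓘(ℝ, E) ∞ M]
  [RiemannianBundle (fun x : M ↦ TangentSpace 𝓘(ℝ, E) x)]

/-- Near a point, the Riemannian norms read in a chart are comparable, up to a factor `2`, with a
fixed seminorm of the model space. -/
theorem exists_seminorm_extChartAt
    [IsContinuousRiemannianBundle E (fun x : M ↦ TangentSpace 𝓘(ℝ, E) x)] (p : M) :
    ∃ (N : Seminorm ℝ E) (A : ℝ), 0 ≤ A ∧ (∀ v, N v ≤ A * ‖v‖) ∧
      (∀ᶠ y in 𝓝 p, ∀ w : TangentSpace 𝓘(ℝ, E) y,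
        N (mfderiv 𝓘(ℝ, E) 𝓘(ℝ, E) (extChartAt 𝓘(ℝ, E) p) y w) ≤ 2 * ‖w‖) ∧
      ∀ᶠ z in 𝓝 (extChartAt 𝓘(ℝ, E) p p), ∀ v : E,
        ‖mfderiv 𝓘(ℝ, E) 𝓘(ℝ, E) (extChartAt 𝓘(ℝ, E) p).symm z v‖ ≤ 2 * N v := by
  set T := trivializationAt E (fun x : M ↦ TangentSpace 𝓘(ℝ, E) x) p with hT
  let B : E →L[ℝ] TangentSpace 𝓘(ℝ, E) p := T.symmL ℝ p
  have hp : p ∈ T.baseSet := FiberBundle.mem_baseSet_trivializationAt' p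
  -- `N` is the Riemannian norm at `p` read in the trivialization at `p`; continuity of the metric
  -- makes nearby norms comparable to it.
  refine ⟨(normSeminorm ℝ (TangentSpace 𝓘(ℝ, E) p)).comp B.toLinearMap, ‖B‖, B.opNorm_nonneg,
    fun v ↦ B.le_opNorm v, ?_, ?_⟩
  · filter_upwards [eventually_norm_symmL_trivializationAt_self_comp_lt E
      (fun x : M ↦ TangentSpace 𝓘(ℝ, E) x) p one_lt_two, chart_source_mem_nhds E p] with y hy hys w
    rw [← TangentBundle.continuousLinearMapAt_trivializationAt hys]
    exact ((B ∘L T.continuousLinearMapAt ℝ y).le_opNorm w).trans (by gcongr)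
  · have key : ∀ᶠ y in 𝓝 p, ∀ v : E, ‖mfderiv 𝓘(ℝ, E) 𝓘(ℝ, E) (extChartAt 𝓘(ℝ, E) p).symm
        (extChartAt 𝓘(ℝ, E) p y) v‖ ≤ 2 * ‖B v‖ := by
      filter_upwards [eventually_norm_symmL_trivializationAt_comp_self_lt E
        (fun x : M ↦ TangentSpace 𝓘(ℝ, E) x) p one_lt_two, chart_source_mem_nhds E p]
        with y hy hys v
      have h1 := ((T.symmL ℝ y ∘L T.continuousLinearMapAt ℝ p).le_opNorm (B v)).trans
        (mul_le_mul_of_nonneg_right hy.le (norm_nonneg _))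
      rw [ContinuousLinearMap.comp_apply, T.continuousLinearMapAt_symmL hp,
        TangentBundle.symmL_trivializationAt hys] at h1
      have A : (extChartAt 𝓘(ℝ, E) p).symm (extChartAt 𝓘(ℝ, E) p y) = y :=
        (extChartAt 𝓘(ℝ, E) p).left_inv (by simpa using hys)
      rw [modelWithCornersSelf_coe, range_id, mfderivWithin_univ] at h1
      convert! h1 using 2
      congr
    have h0 : 𝓝 p = 𝓝 ((extChartAt 𝓘(ℝ, E) p).symm (extChartAt 𝓘(ℝ, E) p p)) := by simp
    rw [h0] at key
    filter_upwards [(continuousAt_extChartAt_symm (I := 𝓘(ℝ, E)) p).preimage_mem_nhds key,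
      extChartAt_target_mem_nhds (I := 𝓘(ℝ, E)) p] with z hz hzt v
    have : z = extChartAt 𝓘(ℝ, E) p ((extChartAt 𝓘(ℝ, E) p).symm z) := by
      rw [(extChartAt 𝓘(ℝ, E) p).right_inv hzt]
    have hz := hz v
    rw [← this] at hz
    exact hz

/-- The Riemannian distance of two points of a chart is bounded by the length of the segment between
them. -/
theorem edist_extChartAt_symm_le [IsRiemannianManifold 𝓘(ℝ, E) M] (p : M) {N : Seminorm ℝ E}
    {s : Set E} (hs : Convex ℝ s) (hst : s ⊆ (extChartAt 𝓘(ℝ, E) p).target) {C : ℝ}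
    (hN : ∀ z ∈ s, ∀ v : E,
      ‖mfderiv 𝓘(ℝ, E) 𝓘(ℝ, E) (extChartAt 𝓘(ℝ, E) p).symm z v‖ ≤ C * N v)
    {z z' : E} (hz : z ∈ s) (hz' : z' ∈ s) :
    edist ((extChartAt 𝓘(ℝ, E) p).symm z) ((extChartAt 𝓘(ℝ, E) p).symm z') ≤
      ENNReal.ofReal (C * N (z' - z)) := by
  let η := ContinuousAffineMap.lineMap (R := ℝ) z z'
  set γ := (extChartAt 𝓘(ℝ, E) p).symm ∘ η
  have hη : Icc 0 1 ⊆ ⇑η ⁻¹' s := by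
    simp only [← image_subset_iff, ContinuousAffineMap.coe_lineMap_eq,
     ← segment_eq_image_lineMap, η]
    exact hs.segment_subset hz hz'
  have η_smooth : ContMDiffOn 𝓘(ℝ, ℝ) 𝓘(ℝ, E) 1 η (Icc 0 1) := by
    apply ContMDiff.contMDiffOn
    rw [contMDiff_iff_contDiff]
    exact ContinuousAffineMap.contDiff _
  rw [IsRiemannianManifold.out (I := 𝓘(ℝ, E))]
  have : Manifold.riemannianEDist 𝓘(ℝ, E) ((extChartAt 𝓘(ℝ, E) p).symm z)
      ((extChartAt 𝓘(ℝ, E) p).symm z') ≤ Manifold.pathELength 𝓘(ℝ, E) γ 0 1 := by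
    apply Manifold.riemannianEDist_le_pathELength _ _ _ zero_le_one
    · exact (contMDiffOn_extChartAt_symm p).comp η_smooth (hη.trans (preimage_mono hst))
    · simp [γ, η, ContinuousAffineMap.coe_lineMap_eq]
    · simp [γ, η, ContinuousAffineMap.coe_lineMap_eq]
  refine this.trans ?_
  rw [Manifold.pathELength_eq_lintegral_mfderivWithin_Icc]
  calc _ ≤ ∫⁻ _ in Icc (0 : ℝ) 1, ENNReal.ofReal (C * N (z' - z)) := by
        refine setLIntegral_mono' measurableSet_Icc fun t ht ↦ ?_
        have hd : mfderivWithin 𝓘(ℝ, ℝ) 𝓘(ℝ, E) γ (Icc 0 1) t =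
            (mfderiv 𝓘(ℝ, E) 𝓘(ℝ, E) (extChartAt 𝓘(ℝ, E) p).symm (η t)) ∘L
              (mfderivWithin 𝓘(ℝ, ℝ) 𝓘(ℝ, E) η (Icc 0 1) t) := by
          apply mfderiv_comp_mfderivWithin
          · have := mdifferentiableWithinAt_extChartAt_symm (I := 𝓘(ℝ, E)) (hst (hη ht))
            rwa [modelWithCornersSelf_coe, range_id, mdifferentiableWithinAt_univ] at this
          · exact η_smooth.mdifferentiableOn one_ne_zero t ht
          · rw [uniqueMDiffWithinAt_iff_uniqueDiffWithinAt]
            exact uniqueDiffOn_Icc zero_lt_one t ht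
        have hη' : (mfderivWithin 𝓘(ℝ, ℝ) 𝓘(ℝ, E) η (Icc 0 1) t) 1 = z' - z := by
          rw [mfderivWithin_eq_fderivWithin]
          have h1 : HasDerivWithinAt η (z' - z) (Icc 0 1) t := by
            simp only [η, ContinuousAffineMap.coe_lineMap_eq]
            exact AffineMap.hasDerivWithinAt_lineMap
          rw [h1.hasFDerivWithinAt.fderivWithin (uniqueDiffOn_Icc zero_lt_one t ht)]
          exact one_smul _ _
        have hd1 : mfderivWithin 𝓘(ℝ, ℝ) 𝓘(ℝ, E) γ (Icc 0 1) t 1 =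
            mfderiv 𝓘(ℝ, E) 𝓘(ℝ, E) (extChartAt 𝓘(ℝ, E) p).symm (η t) (z' - z) := by
          rw [hd, ← hη']; rfl
        rw [hd1, ← ofReal_norm]
        exact ENNReal.ofReal_le_ofReal (hN _ (hη ht) _)
    _ = ENNReal.ofReal (C * N (z' - z)) := by simp

end Charts

/-! ### Calculus of gradient bounds. -/

section GradientBound

open Set Filter Topology Metric

variable {E : Type*} [NormedAddCommGroup E] [NormedSpace ℝ E]
  {M : Type*} [TopologicalSpace M] [ChartedSpace E M]
  [RiemannianBundle (fun x : M ↦ TangentSpace 𝓘(ℝ, E) x)]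

/-- The real function `f` is differentiable at `x`, and its differential has norm at most `C` for
the Riemannian metric. -/
def HasGradientBoundAt (E : Type*) [NormedAddCommGroup E] [NormedSpace ℝ E]
    {M : Type*} [TopologicalSpace M] [ChartedSpace E M]
    [RiemannianBundle (fun x : M ↦ TangentSpace 𝓘(ℝ, E) x)] (f : M → ℝ) (x : M) (C : ℝ) : Prop :=
  ∃ D : TangentSpace 𝓘(ℝ, E) x →L[ℝ] ℝ, HasMFDerivAt 𝓘(ℝ, E) 𝓘(ℝ, ℝ) f x D ∧
    ∀ w, |D w| ≤ C * ‖w‖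

namespace HasGradientBoundAt

variable {f g : M → ℝ} {x : M} {C C' : ℝ}

lemma mono (h : HasGradientBoundAt E f x C) (hC : C ≤ C') : HasGradientBoundAt E f x C' := by
  obtain ⟨D, hD, hD'⟩ := h
  exact ⟨D, hD, fun w ↦ (hD' w).trans (by gcongr)⟩

lemma congr_of_eventuallyEq (h : HasGradientBoundAt E f x C) (hfg : g =ᶠ[𝓝 x] f) :
    HasGradientBoundAt E g x C := by
  obtain ⟨D, hD, hD'⟩ := h
  exact ⟨D, hD.congr_of_eventuallyEq hfg, hD'⟩

variable (E) in
lemma const (c : ℝ) (x : M) : HasGradientBoundAt E (fun _ ↦ c) x 0 :=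
  ⟨0, hasMFDerivAt_const c x, fun w ↦ by simp⟩

lemma add (hf : HasGradientBoundAt E f x C) (hg : HasGradientBoundAt E g x C') :
    HasGradientBoundAt E (f + g) x (C + C') := by
  obtain ⟨D, hD, hD1⟩ := hf
  obtain ⟨D', hD', hD1'⟩ := hg
  refine ⟨D + D', hD.add hD', fun w ↦ ?_⟩
  calc |D w + D' w| ≤ |D w| + |D' w| := abs_add_le _ _
    _ ≤ C * ‖w‖ + C' * ‖w‖ := add_le_add (hD1 w) (hD1' w)
    _ = _ := by ring

lemma sum {ι : Type*} {s : Finset ι} {f : ι → M → ℝ} {C : ι → ℝ}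
    (h : ∀ i ∈ s, HasGradientBoundAt E (f i) x (C i)) :
    HasGradientBoundAt E (∑ i ∈ s, f i) x (∑ i ∈ s, C i) := by
  classical
  induction s using Finset.induction_on with
  | empty => simpa using! const E 0 x
  | insert i s hi ih =>
    rw [Finset.sum_insert hi, Finset.sum_insert hi]
    exact (h i (Finset.mem_insert_self _ _)).add
      (ih fun j hj ↦ h j (Finset.mem_insert_of_mem hj))

lemma mul (hf : HasGradientBoundAt E f x C) (hg : HasGradientBoundAt E g x C') :
    HasGradientBoundAt E (f * g) x (|f x| * C' + |g x| * C) := by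
  obtain ⟨D, hD, hD1⟩ := hf
  obtain ⟨D', hD', hD1'⟩ := hg
  refine ⟨f x • D' + g x • D, hD.mul hD', fun w ↦ ?_⟩
  calc |f x * D' w + g x * D w| ≤ |f x| * |D' w| + |g x| * |D w| := by
        rw [← abs_mul, ← abs_mul]
        exact abs_add_le _ _
    _ ≤ |f x| * (C' * ‖w‖) + |g x| * (C * ‖w‖) := by gcongr <;> solve_by_elim
    _ = _ := by ring

lemma comp {χ : ℝ → ℝ} {c : ℝ} (hχ : HasDerivAt χ c (f x)) (hf : HasGradientBoundAt E f x C) :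
    HasGradientBoundAt E (χ ∘ f) x (|c| * C) := by
  obtain ⟨D, hD, hD1⟩ := hf
  refine ⟨c • D, ?_, fun w ↦ ?_⟩
  · have := hχ.hasFDerivAt.hasMFDerivAt.comp x hD
    have h : c • D = (ContinuousLinearMap.toSpanSingleton ℝ c).comp D := by
      ext w
      exact mul_comm _ _
    rw [h]
    exact this
  · calc |c * D w| = |c| * |D w| := abs_mul _ _
      _ ≤ |c| * (C * ‖w‖) := by gcongr; exact hD1 w
      _ = _ := by ring

end HasGradientBoundAt

/-- Read in the chart, `g` has a continuous, hence locally bounded, differential; the differential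
of the chart is the tangent trivialization, whose norm is locally bounded too. -/
lemma eventually_hasGradientBoundAt [IsManifold 𝓘(ℝ, E) ∞ M]
    [IsContinuousRiemannianBundle E (fun x : M ↦ TangentSpace 𝓘(ℝ, E) x)]
    {g : M → ℝ} (hg : ContMDiff 𝓘(ℝ, E) 𝓘(ℝ, ℝ) ∞ g) (p : M) :
    ∃ C, ∀ᶠ y in 𝓝 p, HasGradientBoundAt E g y C := by
  obtain ⟨C, hC0, hC⟩ := eventually_norm_trivializationAt_lt E
    (fun x : M ↦ TangentSpace 𝓘(ℝ, E) x) p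
  set φ := extChartAt 𝓘(ℝ, E) p with hφ
  have hsm : ContDiffOn ℝ ∞ (g ∘ φ.symm) φ.target := by
    rw [← contMDiffOn_iff_contDiffOn]
    exact hg.comp_contMDiffOn (contMDiffOn_extChartAt_symm p)
  have hop : IsOpen φ.target := isOpen_extChartAt_target p
  have hcd : ContinuousAt (fun z ↦ ‖fderiv ℝ (g ∘ φ.symm) z‖) (φ p) :=
    ((hsm.continuousOn_fderiv_of_isOpen hop (by simp)).continuousAt
      (hop.mem_nhds (mem_extChartAt_target p))).norm
  set A := ‖fderiv ℝ (g ∘ φ.symm) (φ p)‖ + 1 with hA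
  have hev : ∀ᶠ y in 𝓝 p, ‖fderiv ℝ (g ∘ φ.symm) (φ y)‖ < A :=
    (continuousAt_extChartAt (I := 𝓘(ℝ, E)) p).eventually
      (hcd.eventually_lt continuousAt_const (lt_add_one _))
  refine ⟨A * C, ?_⟩
  filter_upwards [hC, hev, chart_source_mem_nhds E p, extChartAt_source_mem_nhds (I := 𝓘(ℝ, E)) p]
    with y hy1 hy2 hy3 hy4
  have hd1 : HasMFDerivAt 𝓘(ℝ, E) 𝓘(ℝ, E) φ y (mfderiv 𝓘(ℝ, E) 𝓘(ℝ, E) φ y) :=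
    (mdifferentiableAt_extChartAt hy3).hasMFDerivAt
  have hd2 : HasFDerivAt (g ∘ φ.symm) (fderiv ℝ (g ∘ φ.symm) (φ y)) (φ y) :=
    ((hsm.contDiffAt (hop.mem_nhds (φ.map_source hy4))).differentiableAt (by simp)).hasFDerivAt
  have hd3 := hd2.hasMFDerivAt.comp y hd1
  refine HasGradientBoundAt.congr_of_eventuallyEq ⟨_, hd3, fun w ↦ ?_⟩ ?_
  · rw [hφ, ← TangentBundle.continuousLinearMapAt_trivializationAt hy3]
    refine (ContinuousLinearMap.le_opNorm (fderiv ℝ (g ∘ φ.symm) (φ y)) _).trans ?_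
    rw [mul_assoc]
    refine mul_le_mul hy2.le ?_ (norm_nonneg (E := E) _) (by positivity)
    exact (((trivializationAt E (fun x : M ↦ TangentSpace 𝓘(ℝ, E) x) p).continuousLinearMapAt
      ℝ y).le_opNorm w).trans (by gcongr)
  · filter_upwards [(isOpen_extChartAt_source (I := 𝓘(ℝ, E)) p).mem_nhds hy4] with q hq
    simp only [Function.comp_apply]
    rw [φ.left_inv hq]

lemma exists_hasGradientBoundAt_of_isCompact [IsManifold 𝓘(ℝ, E) ∞ M]
    [IsContinuousRiemannianBundle E (fun x : M ↦ TangentSpace 𝓘(ℝ, E) x)]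
    {g : M → ℝ} (hg : ContMDiff 𝓘(ℝ, E) 𝓘(ℝ, ℝ) ∞ g) {K : Set M} (hK : IsCompact K) :
    ∃ C, ∀ y ∈ K, HasGradientBoundAt E g y C := by
  refine hK.induction_on (p := fun s ↦ ∃ C, ∀ y ∈ s, HasGradientBoundAt E g y C)
    ⟨0, by simp⟩ (fun s t hst ⟨C, hC⟩ ↦ ⟨C, fun y hy ↦ hC y (hst hy)⟩) ?_ ?_
  · rintro s t ⟨C, hC⟩ ⟨C', hC'⟩
    refine ⟨max C C', ?_⟩
    rintro y (hy | hy)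
    exacts [(hC y hy).mono (le_max_left _ _), (hC' y hy).mono (le_max_right _ _)]
  · intro p _
    obtain ⟨C, hC⟩ := eventually_hasGradientBoundAt hg p
    exact ⟨_, mem_nhdsWithin_of_mem_nhds hC, C, fun y hy ↦ hy⟩

end GradientBound

/-! ### Smooth approximation of Lipschitz functions. -/

section Approximation

open Set Filter Topology Metric

variable {E : Type*} [NormedAddCommGroup E] [NormedSpace ℝ E] [FiniteDimensional ℝ E]
  {M : Type*} [EMetricSpace M] [ChartedSpace E M] [IsManifold 𝓘(ℝ, E) ∞ M]
  [RiemannianBundle (fun x : M ↦ TangentSpace 𝓘(ℝ, E) x)]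
  [IsContinuousRiemannianBundle E (fun x : M ↦ TangentSpace 𝓘(ℝ, E) x)]
  [IsRiemannianManifold 𝓘(ℝ, E) M]

variable (E) in
/-- A Lipschitz function on a Riemannian manifold is locally a uniform limit of smooth functions
with comparable gradient bounds. -/
theorem exists_open_contMDiffOn_approx {f : M → ℝ} {L : NNReal} (hf : LipschitzWith L f) (p : M) :
    ∃ U : Set M, IsOpen U ∧ p ∈ U ∧ ∀ η > 0, ∃ u : M → ℝ,
      ContMDiffOn 𝓘(ℝ, E) 𝓘(ℝ, ℝ) ∞ u U ∧ (∀ x ∈ U, |u x - f x| ≤ η) ∧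
      ∀ x ∈ U, HasGradientBoundAt E u x (4 * L) := by
  obtain ⟨N, A, hA, hNA, h1, h2⟩ := exists_seminorm_extChartAt (E := E) p
  set φ := extChartAt 𝓘(ℝ, E) p with hφ
  obtain ⟨R, hR, hRs⟩ := Metric.mem_nhds_iff.1 (inter_mem (extChartAt_target_mem_nhds p) h2)
  obtain ⟨r, hr, rfl⟩ : ∃ r > 0, R = 2 * r := ⟨R / 2, by positivity, by ring⟩
  -- One factor `2` is lost here, in comparing distance with `N`; another is lost below in returning
  -- from `N` to the Riemannian norm. Hence `4 * L`.
  have hlip : ∀ z ∈ ball (φ p) (2 * r), ∀ z' ∈ ball (φ p) (2 * r),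
      |(f ∘ φ.symm) z - (f ∘ φ.symm) z'| ≤ (2 * L) * N (z - z') := by
    intro z hz z' hz'
    have h : edist (φ.symm z) (φ.symm z') ≤ ENNReal.ofReal (2 * N (z - z')) := by
      rw [edist_comm]
      exact edist_extChartAt_symm_le p (convex_ball _ _) (fun x hx ↦ (hRs hx).1)
        (fun x hx ↦ (hRs hx).2) hz' hz
    have h' : edist (f (φ.symm z)) (f (φ.symm z')) ≤ L * ENNReal.ofReal (2 * N (z - z')) :=
      (hf _ _).trans (by gcongr)
    rw [edist_dist, ← ENNReal.ofReal_coe_nnreal, ← ENNReal.ofReal_mul L.coe_nonneg,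
      ENNReal.ofReal_le_ofReal_iff (by positivity), Real.dist_eq] at h'
    calc _ ≤ _ := h'
      _ = _ := by ring
  refine ⟨φ.source ∩ φ ⁻¹' (ball (φ p) r) ∩ interior {y | ∀ w : TangentSpace 𝓘(ℝ, E) y,
    N (mfderiv 𝓘(ℝ, E) 𝓘(ℝ, E) φ y w) ≤ 2 * ‖w‖}, ?_, ⟨⟨mem_extChartAt_source p,
      mem_ball_self hr⟩, mem_interior_iff_mem_nhds.2 h1⟩, fun η hη ↦ ?_⟩
  · exact ((continuousOn_extChartAt p).isOpen_inter_preimage (isOpen_extChartAt_source p)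
      isOpen_ball).inter isOpen_interior
  obtain ⟨u, hu, hu1, hu2⟩ := exists_contDiff_approx_of_lipschitz_seminorm N hA hNA hr
    (by positivity) hlip hη
  refine ⟨u ∘ φ, ?_, ?_, ?_⟩
  · refine hu.contMDiff.comp_contMDiffOn (contMDiffOn_extChartAt.mono fun x hx ↦ ?_)
    rw [← extChartAt_source 𝓘(ℝ, E)]
    exact hx.1.1
  · rintro x ⟨⟨hx, hx'⟩, -⟩
    simpa [φ.left_inv hx] using hu1 _ hx'
  · rintro x ⟨⟨hx, hx'⟩, hx''⟩
    have hd1 : HasMFDerivAt 𝓘(ℝ, E) 𝓘(ℝ, E) φ x (mfderiv 𝓘(ℝ, E) 𝓘(ℝ, E) φ x) :=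
      (mdifferentiableAt_extChartAt (by rwa [← extChartAt_source 𝓘(ℝ, E)])).hasMFDerivAt
    have hd2 : HasFDerivAt u (fderiv ℝ u (φ x)) (φ x) :=
      (hu.differentiable (by simp)).differentiableAt.hasFDerivAt
    refine ⟨_, hd2.hasMFDerivAt.comp x hd1, fun w ↦ (hu2 _ hx' _).trans ?_⟩
    calc 2 * L * N (mfderiv 𝓘(ℝ, E) 𝓘(ℝ, E) φ x w) ≤ 2 * L * (2 * ‖w‖) := by
          gcongr
          exact interior_subset hx'' w
      _ = _ := by ring

variable (E) in
/-- A nonnegative Lipschitz function is approximated, uniformly on a compact set, by smooth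
functions with comparable gradient bounds. -/
theorem exists_contMDiff_approx [SigmaCompactSpace M] {f : M → ℝ} {L : NNReal}
    (hf : LipschitzWith L f) (hf0 : ∀ x, 0 ≤ f x) {K : Set M} (hK : IsCompact K) {η : ℝ}
    (hη : 0 < η) :
    ∃ F : M → ℝ, ContMDiff 𝓘(ℝ, E) 𝓘(ℝ, ℝ) ∞ F ∧ (∀ x, F x ≤ f x + η) ∧
      (∀ x ∈ K, |F x - f x| ≤ η) ∧ ∀ x ∈ interior K, HasGradientBoundAt E F x (4 * L + η) := by
  choose U hUo hpU hU using fun p ↦ exists_open_contMDiffOn_approx E hf p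
  obtain ⟨t, ht⟩ := hK.elim_nhds_subcover U fun p _ ↦ (hUo p).mem_nhds (hpU p)
  obtain ⟨ρ, hρ⟩ := SmoothPartitionOfUnity.exists_isSubordinate 𝓘(ℝ, E) hK.isClosed
    (fun i : t ↦ U i) (fun i ↦ hUo i) (by simpa [iUnion_subtype] using ht.2)
  choose C hC using fun i : t ↦ exists_hasGradientBoundAt_of_isCompact (ρ i).contMDiff hK
  -- In the gradient of the glued function the errors `u i - f` are multiplied by the gradients of
  -- the `ρ i`, bounded by `C i` on `K`; `η'` makes the total at most `η`.
  obtain ⟨η', hη', hη'1, hη'2⟩ : ∃ η' > 0, η' ≤ η ∧ η' * ∑ i, |C i| ≤ η := by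
    have h0 : 0 ≤ ∑ i, |C i| := Finset.sum_nonneg fun i _ ↦ abs_nonneg _
    refine ⟨min η (η / (∑ i, |C i| + 1)), by positivity, min_le_left _ _, ?_⟩
    calc _ ≤ η / (∑ i, |C i| + 1) * ∑ i, |C i| := by gcongr; exact min_le_right _ _
      _ = η * (∑ i, |C i| / (∑ i, |C i| + 1)) := by
        rw [← Finset.sum_div]
        ring
      _ ≤ η * 1 := by
        gcongr
        rw [← Finset.sum_div, div_le_one (by positivity)]
        linarith
      _ = η := mul_one _
  choose u hu1 hu2 hu3 using fun i : t ↦ hU i η' hη'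
  have hsum1 : ∀ x ∈ K, ∑ i, ρ i x = 1 := fun x hx ↦ by
    rw [← finsum_eq_sum_of_fintype, ρ.sum_eq_one hx]
  have hsum2 : ∀ x, ∑ i, ρ i x ≤ 1 := fun x ↦ by
    rw [← finsum_eq_sum_of_fintype]
    exact ρ.sum_le_one x
  have hsupp : ∀ i x, ρ i x ≠ 0 → x ∈ U i := fun i x hx ↦ hρ i (subset_tsupport _ hx)
  have hterm : ∀ i x, |ρ i x * (u i x - f x)| ≤ ρ i x * η' := fun i x ↦ by
    by_cases h : ρ i x = 0
    · simp [h]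
    rw [abs_mul, abs_of_nonneg (ρ.nonneg i x)]
    exact mul_le_mul_of_nonneg_left (hu2 i x (hsupp i x h)) (ρ.nonneg i x)
  have hsumle : ∀ x, |∑ i, ρ i x * (u i x - f x)| ≤ η' := fun x ↦
    calc _ ≤ ∑ i, |ρ i x * (u i x - f x)| := Finset.abs_sum_le_sum_abs _ _
      _ ≤ ∑ i, ρ i x * η' := Finset.sum_le_sum fun i _ ↦ hterm i x
      _ = (∑ i, ρ i x) * η' := (Finset.sum_mul _ _ _).symm
      _ ≤ 1 * η' := by gcongr; exact hsum2 x
      _ = η' := one_mul _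
  have hsplit : ∀ x (c : ℝ), ∑ i, ρ i x * u i x =
      ∑ i, ρ i x * (u i x - c) + (∑ i, ρ i x) * c := fun x c ↦ by
    rw [Finset.sum_mul, ← Finset.sum_add_distrib]
    exact Finset.sum_congr rfl fun i _ ↦ by ring
  refine ⟨fun x ↦ ∑ i, ρ i x * u i x, ?_, fun x ↦ ?_, fun x hx ↦ ?_, fun x hx ↦ ?_⟩
  · have := hρ.contMDiff_finsum_smul (fun i ↦ hUo i) hu1
    simpa only [finsum_eq_sum_of_fintype, smul_eq_mul] using this
  -- Off `K` the weights may sum to less than `1`, and `0 ≤ f` still gives the upper bound.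
  · have h1 := (abs_le.1 (hsumle x)).2
    have h2 : (∑ i, ρ i x) * f x ≤ 1 * f x := mul_le_mul_of_nonneg_right (hsum2 x) (hf0 x)
    dsimp only
    rw [hsplit x (f x)]
    linarith
  · dsimp only
    rw [hsplit x (f x), hsum1 x hx, one_mul, add_sub_cancel_right]
    exact (hsumle x).trans hη'1
  · have hxK : x ∈ K := interior_subset hx
    -- `f` need not be differentiable, so the constant `f x` is subtracted instead. Near `x` the
    -- weights sum to `1`, hence this changes the glued function only by a constant, while at `x`
    -- the factor `u i - f x` is at most `η'` on the support of `ρ i`.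
    have hi : ∀ i ∈ Finset.univ, HasGradientBoundAt E (fun y ↦ ρ i y * (u i y - f x)) x
        (ρ i x * (4 * L) + η' * |C i|) := by
      intro i _
      by_cases hxi : x ∈ tsupport (ρ i)
      · have hxU : x ∈ U i := hρ i hxi
        have h1 := (hu3 i x hxU).add (HasGradientBoundAt.const E (-f x) x)
        refine ((hC i x hxK).mul h1).mono ?_
        rw [abs_of_nonneg (ρ.nonneg i x), add_zero]
        refine add_le_add le_rfl ((mul_le_mul_of_nonneg_left (le_abs_self _) (abs_nonneg _)).trans
          (mul_le_mul_of_nonneg_right ?_ (abs_nonneg _)))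
        rw [Pi.add_apply, ← sub_eq_add_neg]
        exact hu2 i x hxU
      · refine ((HasGradientBoundAt.const E 0 x).congr_of_eventuallyEq ?_).mono ?_
        · filter_upwards [(isClosed_tsupport (ρ i)).isOpen_compl.mem_nhds hxi] with y hy
          rw [image_eq_zero_of_notMem_tsupport hy, zero_mul]
        · have := ρ.nonneg i x
          positivity
    refine (((HasGradientBoundAt.sum hi).add
      (HasGradientBoundAt.const E (f x) x)).congr_of_eventuallyEq ?_).mono ?_
    · filter_upwards [isOpen_interior.mem_nhds hx] with y hy
      rw [hsplit y (f x), hsum1 y (interior_subset hy), one_mul]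
      simp
    · rw [Finset.sum_add_distrib, ← Finset.sum_mul, ← Finset.mul_sum, hsum1 x hxK]
      linarith

end Approximation

/-! ### Cutoff functions with small gradient. -/

section CutoffFunctions

open Set Filter Topology Metric

variable {X : Type*} [EMetricSpace X]

lemma lipschitzWith_toReal_edist (hX : ∀ x y : X, edist x y ≠ ⊤) (p : X) :
    LipschitzWith 1 (fun x ↦ (edist p x).toReal) := by
  have key : ∀ x y : X, (edist p x).toReal - (edist p y).toReal ≤ (edist x y).toReal := by
    intro x y
    rw [sub_le_iff_le_add, ← ENNReal.toReal_add (hX _ _) (hX _ _)]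
    refine ENNReal.toReal_mono (ENNReal.add_ne_top.2 ⟨hX _ _, hX _ _⟩) ?_
    rw [add_comm, edist_comm x y]
    exact edist_triangle _ _ _
  intro x y
  rw [ENNReal.coe_one, one_mul, edist_dist, ENNReal.ofReal_le_iff_le_toReal (hX x y), Real.dist_eq,
    abs_le]
  have h1 := key x y
  have h2 := key y x
  rw [edist_comm y x] at h2
  constructor <;> linarith

variable (E : Type*) [NormedAddCommGroup E] [NormedSpace ℝ E] [FiniteDimensional ℝ E]
  {M : Type*} [EMetricSpace M] [ChartedSpace E M] [IsManifold 𝓘(ℝ, E) ∞ M]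
  [RiemannianBundle (fun x : M ↦ TangentSpace 𝓘(ℝ, E) x)]
  [IsContinuousRiemannianBundle E (fun x : M ↦ TangentSpace 𝓘(ℝ, E) x)]
  [IsRiemannianManifold 𝓘(ℝ, E) M] [ConnectedSpace M] [CompleteSpace M]

/-- A connected complete Riemannian manifold carries smooth compactly supported functions which are
equal to `1` on a given unit ball and have arbitrarily small gradient. -/
theorem exists_cutoff_small_gradient (p : M) {ε : ℝ} (hε : 0 < ε) :
    ∃ G : M → ℝ, ContMDiff 𝓘(ℝ, E) 𝓘(ℝ, ℝ) ∞ G ∧ HasCompactSupport G ∧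
      (∀ x ∈ eball p 1, G x = 1) ∧ ∀ x, HasGradientBoundAt E G x ε := by
  have hfin : ∀ x y : M, edist x y ≠ ⊤ := edist_ne_top_of_connectedSpace
  have : LocallyCompactSpace M := ChartedSpace.locallyCompactSpace E M
  have hint := IsRiemannianManifold.hasIntermediatePoints 𝓘(ℝ, E) M
  have : SigmaCompactSpace M := sigmaCompactSpace_of_hasIntermediatePoints hint
  -- The thresholds `1/4` and `1/2` leave room for an error `δ ≤ 1/8`: the tent is at least `3/4` on
  -- the unit ball and `0` far away.
  set χ : ℝ → ℝ := fun t ↦ Real.smoothTransition (4 * t - 1)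
  have hχ : ContDiff ℝ ∞ χ := by fun_prop
  have hχ0 : ∀ t ≤ 1 / 4, χ t = 0 := fun t ht ↦
    Real.smoothTransition.zero_of_nonpos (by linarith)
  have hχ1 : ∀ t, 1 / 2 ≤ t → χ t = 1 := fun t ht ↦
    Real.smoothTransition.one_of_one_le (by linarith)
  -- On the ball supporting the tent, the approximation takes values in `[-δ, 1 + δ] ⊆ [-1, 2]`.
  obtain ⟨A, hA⟩ := (isCompact_Icc (a := (-1 : ℝ)) (b := 2)).exists_bound_of_continuousOn
    (hχ.continuous_deriv (by simp)).continuousOn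
  have hA0 : 0 ≤ A := (norm_nonneg _).trans (hA 0 (by norm_num))
  -- `5 * δ` is the gradient bound `4 * L + η` with `L = η = δ`, and `A` is the cost of composing
  -- with `χ`.
  obtain ⟨δ, hδ, hδ1, hδε⟩ : ∃ δ : ℝ, 0 < δ ∧ δ ≤ 1 / 8 ∧ A * (5 * δ) ≤ ε := by
    refine ⟨min (1 / 8) (ε / (5 * (A + 1))), by positivity, min_le_left _ _, ?_⟩
    calc A * (5 * min (1 / 8) (ε / (5 * (A + 1)))) ≤ A * (5 * (ε / (5 * (A + 1)))) := by
            gcongr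
            exact min_le_right _ _
        _ = ε * (A / (A + 1)) := by field_simp
        _ ≤ ε * 1 := by
            gcongr
            rw [div_le_one (by positivity)]
            linarith
        _ = ε := mul_one _
  lift δ to NNReal using hδ.le
  rw [NNReal.coe_pos] at hδ
  set f : M → ℝ := fun x ↦ max (1 - δ * (edist p x).toReal) 0 with hf
  have hflip : LipschitzWith δ f := by
    have h1 : LipschitzWith δ (fun t : ℝ ↦ max (1 - δ * t) 0) := by
      refine LipschitzWith.max_const (LipschitzWith.of_dist_le_mul fun s t ↦ ?_) 0
      rw [Real.dist_eq, Real.dist_eq, abs_sub_comm s t, ← abs_of_nonneg δ.coe_nonneg, ← abs_mul]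
      apply le_of_eq
      congr 1
      rw [abs_of_nonneg δ.coe_nonneg]
      ring
    simpa using! h1.comp (lipschitzWith_toReal_edist hfin p)
  have hf0 : ∀ x, 0 ≤ f x := fun x ↦ le_max_right _ _
  have hf1 : ∀ x, f x ≤ 1 := fun x ↦ max_le (by simp; positivity) zero_le_one
  have hfball : ∀ x ∈ eball p 1, 3 / 4 ≤ f x := by
    intro x hx
    rw [mem_eball, edist_comm] at hx
    have h1 : (edist p x).toReal ≤ 1 :=
      ENNReal.toReal_le_of_le_ofReal zero_le_one (by simpa using hx.le)
    refine le_trans ?_ (le_max_left _ _)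
    nlinarith [ENNReal.toReal_nonneg (a := edist p x)]
  set R : NNReal := δ⁻¹
  have hfR : ∀ x ∉ closedEBall p (R : ℝ≥0∞), f x = 0 := by
    intro x hx
    rw [mem_closedEBall, not_le, edist_comm, ← ENNReal.coe_toNNReal (hfin p x)] at hx
    have h1 : δ⁻¹ < (edist p x).toNNReal := by exact_mod_cast hx
    rw [inv_lt_iff_one_lt_mul₀ hδ] at h1
    refine max_eq_right ?_
    have : (1 : ℝ) < (edist p x).toReal * δ := by
      rw [← ENNReal.coe_toNNReal_eq_toReal]
      exact_mod_cast h1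
    linarith
  -- The extra `1` puts the ball of radius `R` in the interior of the compact set, where the
  -- gradient bound is available.
  have hKc : IsCompact (closedEBall p ((R + 1 : NNReal) : ℝ≥0∞)) :=
    isCompact_closedEBall hint p (R + 1)
  have hBK : closedEBall p (R : ℝ≥0∞) ⊆ interior (closedEBall p ((R + 1 : NNReal) : ℝ≥0∞)) := by
    refine Subset.trans ?_ (interior_maximal eball_subset_closedEBall isOpen_eball)
    intro x hx
    rw [mem_eball]
    refine lt_of_le_of_lt (mem_closedEBall.1 hx) ?_
    exact_mod_cast lt_add_one R
  obtain ⟨F, hFs, hF1, hF2, hF3⟩ :=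
    exists_contMDiff_approx E hflip hf0 hKc (NNReal.coe_pos.2 hδ)
  -- Only the global upper bound on `F` is needed, since `χ` vanishes on all of `(-∞, 1/4]`.
  have hGout : ∀ x ∉ closedEBall p (R : ℝ≥0∞), (χ ∘ F) x = 0 := fun x hx ↦ by
    refine hχ0 _ ((hF1 x).trans ?_)
    rw [hfR x hx]
    linarith
  have hRK : closedEBall p (R : ℝ≥0∞) ⊆ closedEBall p ((R + 1 : NNReal) : ℝ≥0∞) :=
    hBK.trans interior_subset
  refine ⟨χ ∘ F, hχ.contMDiff.comp hFs, ?_, fun x hx ↦ ?_, fun x ↦ ?_⟩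
  · exact HasCompactSupport.intro (isCompact_closedEBall hint p R) hGout
  · have h34 := hfball x hx
    have hxR : x ∈ closedEBall p (R : ℝ≥0∞) := by
      by_contra h
      rw [hfR x h] at h34
      norm_num at h34
    have := (abs_le.1 (hF2 x (hRK hxR))).1
    exact hχ1 _ (by linarith)
  · by_cases hx : x ∈ closedEBall p (R : ℝ≥0∞)
    · have hFx := abs_le.1 (hF2 x (hRK hx))
      have hd : HasDerivAt χ (deriv χ (F x)) (F x) :=
        (hχ.differentiable (by simp)).differentiableAt.hasDerivAt
      refine (HasGradientBoundAt.comp hd (hF3 x (hBK hx))).mono (le_trans ?_ hδε)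
      have h1 : |deriv χ (F x)| ≤ A :=
        hA _ ⟨by linarith [hFx.1, hf0 x], by linarith [hFx.2, hf1 x]⟩
      calc _ ≤ A * (4 * δ + δ) := by gcongr
        _ = _ := by ring
    · refine ((HasGradientBoundAt.const E 0 x).congr_of_eventuallyEq ?_).mono hε.le
      filter_upwards [isClosed_closedEBall.isOpen_compl.mem_nhds hx] with y hy using hGout y hy

end CutoffFunctions

/-! ### Positivity of the volume of open sets. -/

section VolumePositivity

open Set Filter Topology

variable {n : ℕ} {M : Type*} [TopologicalSpace M] [ChartedSpace (EuclideanSpace ℝ (Fin n)) M]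
  [IsManifold (𝓡 n) ∞ M] [RiemannianBundle (fun x : M ↦ TangentSpace (𝓡 n) x)]

/-- The differential of the inverse chart is injective, so this is the Gram determinant of
independent vectors. -/
lemma det_gramMatrix_chartAt_pos (p : M) {y : EuclideanSpace ℝ (Fin n)}
    (hy : y ∈ (chartAt (EuclideanSpace ℝ (Fin n)) p).target) :
    0 < (gramMatrix (chartAt (EuclideanSpace ℝ (Fin n)) p) y).det := by
  set e := chartAt (EuclideanSpace ℝ (Fin n)) p
  have he : e.MDifferentiable (𝓡 n) (𝓡 n) := mdifferentiable_chart p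
  let D : EuclideanSpace ℝ (Fin n) →ₗ[ℝ] TangentSpace (𝓡 n) (e.symm y) :=
    (mfderiv (𝓡 n) (𝓡 n) e.symm y).toLinearMap
  have hD : Function.Injective D := he.symm.mfderiv_injective hy
  have hlin : LinearIndependent ℝ (fun i : Fin n ↦ D (EuclideanSpace.single i (1 : ℝ))) := by
    have h := (EuclideanSpace.basisFun (Fin n) ℝ).toBasis.linearIndependent.map' D
      (LinearMap.ker_eq_bot.2 hD)
    convert! h using 2
    simp
  exact (Matrix.posDef_gram_of_linearIndependent hlin).det_pos

/-- Supplies the measurability of the volume density. The coordinate fields are continuous sections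
of the tangent bundle, and the metric is continuous. -/
lemma continuousOn_gramMatrix_chartAt
    [IsContinuousRiemannianBundle (EuclideanSpace ℝ (Fin n)) (fun x : M ↦ TangentSpace (𝓡 n) x)]
    (p : M) : ContinuousOn (gramMatrix (chartAt (EuclideanSpace ℝ (Fin n)) p))
      (chartAt (EuclideanSpace ℝ (Fin n)) p).target := by
  set e := chartAt (EuclideanSpace ℝ (Fin n)) p
  have hsm : ContMDiffOn (𝓡 n) (𝓡 n) 1 e.symm e.target := contMDiffOn_chart_symm
  have hsec : ∀ v : EuclideanSpace ℝ (Fin n), ContinuousOn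
      (fun y ↦ (⟨e.symm y, mfderiv (𝓡 n) (𝓡 n) e.symm y v⟩ : TotalSpace (EuclideanSpace ℝ (Fin n))
        (fun x : M ↦ TangentSpace (𝓡 n) x))) e.target := by
    intro v
    have h1 := hsm.continuousOn_tangentMapWithin le_rfl e.open_target.uniqueMDiffOn
    have h2 : Continuous (fun y : EuclideanSpace ℝ (Fin n) ↦
        (⟨y, v⟩ : TangentBundle (𝓡 n) (EuclideanSpace ℝ (Fin n)))) :=
      (tangentBundleModelSpaceHomeomorph (𝓡 n)).symm.continuous.comp
        (Continuous.prodMk continuous_id continuous_const)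
    refine (h1.comp h2.continuousOn fun y hy ↦ hy).congr fun y hy ↦ ?_
    simp only [Function.comp_apply, tangentMapWithin]
    rw [mfderivWithin_of_isOpen e.open_target hy]
  refine continuousOn_pi.2 fun i ↦ continuousOn_pi.2 fun j ↦ ?_
  exact (hsec _).inner_bundle (hsec _)

/-- A single chart volume suffices: its density is positive, and a nonempty open set of coordinates
has positive Lebesgue measure. -/
lemma volumeMeasure_ne_zero_of_isOpen [MeasurableSpace M] [BorelSpace M]
    [IsContinuousRiemannianBundle (EuclideanSpace ℝ (Fin n)) (fun x : M ↦ TangentSpace (𝓡 n) x)]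
    {U : Set M} (hU : IsOpen U) (hne : U.Nonempty) : volumeMeasure n M U ≠ 0 := by
  obtain ⟨p, hp⟩ := hne
  set e := chartAt (EuclideanSpace ℝ (Fin n)) p with he
  have hle : chartVolume e ≤ volumeMeasure n M :=
    le_iSup₂ (f := fun e _ ↦ chartVolume e) e (chart_mem_atlas _ p)
  intro h0
  have h1 : chartVolume e U = 0 := le_antisymm ((hle U).trans h0.le) zero_le
  have hdens : AEMeasurable (fun y ↦ ENNReal.ofReal (Real.sqrt (gramMatrix e y).det))
      (volume.restrict e.target) := by
    refine ContinuousOn.aemeasurable ?_ e.open_target.measurableSet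
    have hdet : ContinuousOn (fun y ↦ (gramMatrix e y).det) e.target :=
      (continuous_id.matrix_det).comp_continuousOn (continuousOn_gramMatrix_chartAt p)
    exact ENNReal.continuous_ofReal.comp_continuousOn (Real.continuous_sqrt.comp_continuousOn hdet)
  have : Nonempty M := ⟨p⟩
  have hsymm : AEMeasurable e.symm (volume.restrict e.target) :=
    e.continuousOn_symm.aemeasurable e.open_target.measurableSet
  rw [chartVolume, Measure.map_apply_of_aemeasurable
    (hsymm.mono_ac (withDensity_absolutelyContinuous _ _)) hU.measurableSet,
    withDensity_apply_eq_zero' hdens] at h1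
  have hV : IsOpen (e.target ∩ e.symm ⁻¹' U) := e.symm.isOpen_inter_preimage hU
  have hVne : (e.target ∩ e.symm ⁻¹' U).Nonempty :=
    ⟨e p, e.map_source (mem_chart_source _ p), by
      rw [mem_preimage, e.left_inv (mem_chart_source _ p)]; exact hp⟩
  refine (hV.measure_pos volume hVne).ne' ?_
  have h2 : (volume.restrict e.target) (e.target ∩ e.symm ⁻¹' U) = 0 := by
    refine measure_mono_null ?_ h1
    rintro y ⟨hy, hyU⟩
    exact ⟨(ENNReal.ofReal_pos.2 (Real.sqrt_pos.2 (det_gramMatrix_chartAt_pos p hy))).ne', hyU⟩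
  rwa [Measure.restrict_apply hV.measurableSet, inter_eq_left.2 inter_subset_left] at h2

end VolumePositivity

/-! ### Rayleigh quotients and the conclusion. -/

section RayleighQuotient

open Filter Topology

variable {n : ℕ} {M : Type*}

lemma norm_grad_le [TopologicalSpace M] [ChartedSpace (EuclideanSpace ℝ (Fin n)) M]
    [RiemannianBundle (fun x : M ↦ TangentSpace (𝓡 n) x)] {f : M → ℝ} {x : M} {C : ℝ}
    (h : HasGradientBoundAt (EuclideanSpace ℝ (Fin n)) f x C) (hC : 0 ≤ C) :
    ‖grad (n := n) f x‖ ≤ C := by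
  obtain ⟨D, hD, hDC⟩ := h
  have : FiniteDimensional ℝ (TangentSpace (𝓡 n) x) :=
    inferInstanceAs (FiniteDimensional ℝ (EuclideanSpace ℝ (Fin n)))
  have : CompleteSpace (TangentSpace (𝓡 n) x) := FiniteDimensional.complete ℝ _
  have hgrad : grad (n := n) f x = (InnerProductSpace.toDual ℝ (TangentSpace (𝓡 n) x)).symm D :=
    congrArg (InnerProductSpace.toDual ℝ (TangentSpace (𝓡 n) x)).symm hD.mfderiv
  rw [hgrad, LinearIsometryEquiv.norm_map]
  exact ContinuousLinearMap.opNorm_le_bound _ hC hDC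

/-- The numerator is at most `ε²` times the total volume, and the denominator is at least the volume
of `s`. -/
lemma rayleighQuotient_le [TopologicalSpace M] [ChartedSpace (EuclideanSpace ℝ (Fin n)) M]
    [RiemannianBundle (fun x : M ↦ TangentSpace (𝓡 n) x)] [MeasurableSpace M]
    {f : M → ℝ} {s : Set M} (hs : MeasurableSet s) (hf : ∀ x ∈ s, f x = 1) {ε : ℝ} (hε : 0 ≤ ε)
    (h : ∀ x, HasGradientBoundAt (EuclideanSpace ℝ (Fin n)) f x ε) :
    rayleighQuotient (n := n) f ≤
      ENNReal.ofReal (ε ^ 2) * (volumeMeasure n M Set.univ / volumeMeasure n M s) := by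
  rw [← mul_div_assoc, ← lintegral_const]
  refine ENNReal.div_le_div (lintegral_mono fun x ↦ ENNReal.ofReal_le_ofReal ?_) ?_
  · gcongr
    exact norm_grad_le (h x) hε
  · calc volumeMeasure n M s = ∫⁻ _ in s, 1 ∂volumeMeasure n M := by simp
      _ ≤ ∫⁻ x in s, ENNReal.ofReal (f x ^ 2) ∂volumeMeasure n M :=
        setLIntegral_mono' hs fun x hx ↦ by simp [hf x hx]
      _ ≤ _ := setLIntegral_le_lintegral _ _

/-- The bottom of the spectrum of a connected complete Riemannian manifold of finite volume vanishes. -/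
theorem bottomSpectrum_eq_zero_of_volumeMeasure_lt_top (n : ℕ) {M : Type*} [EMetricSpace M]
    [ChartedSpace (EuclideanSpace ℝ (Fin n)) M] [IsManifold (𝓡 n) ∞ M]
    [RiemannianBundle (fun x : M ↦ TangentSpace (𝓡 n) x)]
    [IsContMDiffRiemannianBundle (𝓡 n) ∞ (EuclideanSpace ℝ (Fin n))
      (fun x : M ↦ TangentSpace (𝓡 n) x)]
    [IsRiemannianManifold (𝓡 n) M]
    [ConnectedSpace M] [CompleteSpace M]
    [MeasurableSpace M] [BorelSpace M]
    (hvol : volumeMeasure n M Set.univ < ⊤) :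
    bottomSpectrum n M = 0 := by
  have : IsContinuousRiemannianBundle (EuclideanSpace ℝ (Fin n))
    (fun x : M ↦ TangentSpace (𝓡 n) x) := by
    obtain ⟨g, hg, hgi⟩ := IsContMDiffRiemannianBundle.exists_contMDiff (IB := 𝓡 n) (n := ∞)
      (F := EuclideanSpace ℝ (Fin n)) (E := fun x : M ↦ TangentSpace (𝓡 n) x)
    exact ⟨g, hg.continuous, hgi⟩
  obtain ⟨p⟩ := (inferInstance : Nonempty M)
  have hp : p ∈ Metric.eball p 1 := Metric.mem_eball_self one_pos
  -- Finiteness of the total volume and positivity of the ball's volume both enter here; without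
  -- them the product with `ε²` need not tend to `0` in `[0, ∞]`.
  have hc : volumeMeasure n M Set.univ / volumeMeasure n M (Metric.eball p 1) ≠ ⊤ :=
    ENNReal.div_ne_top hvol.ne (volumeMeasure_ne_zero_of_isOpen Metric.isOpen_eball ⟨p, hp⟩)
  have hlim : Tendsto (fun ε : ℝ ↦ ENNReal.ofReal (ε ^ 2) *
      (volumeMeasure n M Set.univ / volumeMeasure n M (Metric.eball p 1))) (𝓝[>] 0) (𝓝 0) := by
    have h1 : Tendsto (fun ε : ℝ ↦ ENNReal.ofReal (ε ^ 2)) (𝓝[>] 0) (𝓝 0) := by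
      have : Continuous (fun ε : ℝ ↦ ENNReal.ofReal (ε ^ 2)) :=
        ENNReal.continuous_ofReal.comp (continuous_pow 2)
      simpa using (this.tendsto 0).mono_left nhdsWithin_le_nhds
    simpa using ENNReal.Tendsto.mul_const h1 (Or.inr hc)
  refine le_antisymm (ge_of_tendsto hlim ?_) zero_le
  filter_upwards [self_mem_nhdsWithin] with ε hε
  obtain ⟨G, hG, hGc, hG1, hGε⟩ :=
    exists_cutoff_small_gradient (EuclideanSpace ℝ (Fin n)) p (Set.mem_Ioi.1 hε)
  have hG0 : G ≠ 0 := fun h ↦ by simpa [h] using hG1 p hp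
  exact (iInf₂_le G ⟨hG, hGc, hG0⟩).trans
    (rayleighQuotient_le Metric.isOpen_eball.measurableSet hG1 (le_of_lt hε) hGε)

end RayleighQuotient

end OpenRiemannian

end

theorem mainTheorem3 (n : ℕ) {M : Type*} [EMetricSpace M]
    [ChartedSpace (EuclideanSpace ℝ (Fin n)) M] [IsManifold (𝓡 n) ∞ M]
    [RiemannianBundle (fun x : M ↦ TangentSpace (𝓡 n) x)]
    [IsContMDiffRiemannianBundle (𝓡 n) ∞ (EuclideanSpace ℝ (Fin n))
      (fun x : M ↦ TangentSpace (𝓡 n) x)]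
    [IsRiemannianManifold (𝓡 n) M]
    [ConnectedSpace M] [CompleteSpace M] [NoncompactSpace M]
    [MeasurableSpace M] [BorelSpace M]
    (hvol : OpenRiemannian.volumeMeasure n M Set.univ < ⊤) :
    OpenRiemannian.bottomSpectrum n M = 0 := by
  exact OpenRiemannian.bottomSpectrum_eq_zero_of_volumeMeasure_lt_top n hvol
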